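/- Let $S\ge 2$ and $d\ge 1$ be integers with $S\mid d$, let $T\ge 0$ be an integer, and put $\alpha=1/S$, $\ell=d-d/S$ and $\varphi=T\log_2(d)/d$. Assume $\varphi\le\alpha$. For $s\in\{0,\dots,S-1\}$ let $\mathcal I(s)=\{s(d-\ell),\dots,(s+1)(d-\ell)-1\}\subset\{0,\dots,d-1\}$. For $k\in\{0,1\}^d$ let $$|\mu(k)\rangle=\frac1{\sqrt d}\sum_{j=0}^{d-1}(-1)^{k_j}|j\rangle\in\mathbb C^d ,$$ and let the signature of the symbol $s$ under the key $k$ be the substring of $k$ on the positions outside $\mathcal I(s)$. To verify an alleged signature $\kappa\in\{0,1\}^{\ell}$ of the symbol $t$, one performs on $|\mu(k)\rangle$ the projective measurement $\{|\psi\rangle\langle\psi|,\,1-|\psi\rangle\langle\psi|\}$ (outcomes $1$ and $0$), where $|\psi\rangle$ is the normalisation of the sum of all $|\mu(k')\rangle$, $k'\in\{0,1\}^d$, whose restriction to the positions outside $\mathcal I(t)$ equals $\kappa$. Let $t\neq s$, and let $k\in\{0,1\}^d$ be uniformly random. An attacker receives the signature of $s$ under $k$ together with $|\mu(k)\rangle^{\otimes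 T}$, performs an arbitrary quantum measurement (POVM, possibly depending on the signature received) and outputs an alleged signature $\kappa\in\{0,1\}^\ell$ of $t$; this is then verified on $|\mu(k)\rangle$. Let $J$ be the probability that the outcome of the verification is $0$. Then for every such attacker $$1-J\le p_1,\qquad p_1=(1-\alpha)\left[\left(1-\frac{\alpha}{1-\alpha}\,2h^{-1}\!\left(1-\frac{\varphi}{\alpha}\right)\right)^2+\sqrt{\frac83}\cdot\frac{\sqrt{d-\ell}}{\ell}\right],$$ where $h^{-1}:[0,1]\to[0,\tfrac12]$ is the inverse of the restriction to $[0,\tfrac12]$ of the binary entropy function $h(p)=p\log_2\frac1p+(1-p)\log_2\frac1{1-p}$. -/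

import Mathlib

noncomputable section

namespace QSig

open scoped BigOperators InnerProductSpace ComplexOrder

/-- Length `ℓ = d - d / S` of a revealed substring (for `S` dividing `d`). -/
def revealedLength (S d : ℕ) : ℕ := d - d / S

/-- The set `I(s) = {s (d - ℓ), …, (s + 1)(d - ℓ) - 1}` of positions of the private key that are
not revealed when the symbol `s` is signed. -/
def hidden (S d : ℕ) (s : Fin S) : Finset (Fin d) :=
  Finset.univ.filter fun j =>
    (s : ℕ) * (d - revealedLength S d) ≤ (j : ℕ) ∧
      (j : ℕ) < ((s : ℕ) + 1) * (d - revealedLength S d)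

/-- Strings `κ` of bits indexed by the positions outside `I(s)`: the possible signatures of the
symbol `s` on one qudit. -/
abbrev Signature (S d : ℕ) (s : Fin S) : Type := {j : Fin d // j ∉ hidden S d s} → Bool

/-- The genuine signature of the symbol `s` under the private key `k`: the substring of `k`
outside `I(s)`. -/
def sign {S d : ℕ} (k : Fin d → Bool) (s : Fin S) : Signature S d s := fun j => k j

/-- The fingerprinting state `|μ(k)⟩ = d^(-1/2) ∑ j, (-1)^(k j) |j⟩`, the public key of `k`. -/
def fingerprint {d : ℕ} (k : Fin d → Bool) : EuclideanSpace ℂ (Fin d) :=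
  WithLp.toLp 2 fun j => ((1 / Real.sqrt d : ℝ) : ℂ) * (if k j then -1 else 1)

/-- The state `|μ(k)⟩^{⊗ T}`, in the product basis of `(ℂ^d)^{⊗ T}` (indexed by
`Fin T → Fin d`). -/
def copies {d : ℕ} (T : ℕ) (k : Fin d → Bool) : EuclideanSpace ℂ (Fin T → Fin d) :=
  WithLp.toLp 2 fun i => ∏ a, fingerprint k (i a)

/-- The sum of all fingerprinting states that are consistent with the signature `κ` of `t`. -/
def verifVector {S d : ℕ} (t : Fin S) (κ : Signature S d t) : EuclideanSpace ℂ (Fin d) :=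
  ∑ k ∈ Finset.univ.filter (fun k : Fin d → Bool => sign k t = κ), fingerprint k

/-- The normalised state `|ψ⟩` onto which the verifier projects. -/
def verifState {S d : ℕ} (t : Fin S) (κ : Signature S d t) : EuclideanSpace ℂ (Fin d) :=
  ((‖verifVector t κ‖⁻¹ : ℝ) : ℂ) • verifVector t κ

/-- Probability that the projective measurement `{|ψ⟩⟨ψ|, 1 - |ψ⟩⟨ψ|}` that verifies the
signature `κ` of `t` gives the outcome `1` (accept) on the public key `|μ(k)⟩`. -/
def probOne {S d : ℕ} (t : Fin S) (κ : Signature S d t) (k : Fin d → Bool) : ℝ :=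
  ‖⟪verifState t κ, fingerprint k⟫_ℂ‖ ^ 2

/-- Probability of the complementary outcome `0` of that measurement. -/
def probZero {S d : ℕ} (t : Fin S) (κ : Signature S d t) (k : Fin d → Bool) : ℝ :=
  1 - probOne t κ k

/-- A quantum measurement (POVM) with outcomes in `Ω` on the space `ℂ^n`. -/
structure Povm (n Ω : Type) [Fintype n] [DecidableEq n] [Fintype Ω] where
  /-- the effect of each outcome -/
  effect : Ω → Matrix n n ℂ
  posSemidef : ∀ ω, (effect ω).PosSemidef
  sum_eq_one : ∑ ω, effect ω = 1

/-- Born rule: the probability of the outcome `ω` on the pure state `v`. -/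
def Povm.prob {n Ω : Type} [Fintype n] [DecidableEq n] [Fintype Ω] (M : Povm n Ω)
    (v : EuclideanSpace ℂ n) (ω : Ω) : ℝ :=
  (star v.ofLp ⬝ᵥ (M.effect ω).mulVec v.ofLp).re

/-- An attack on one qudit: having seen the genuine signature of the symbol `s`, the attacker
performs an arbitrary measurement (which may depend on that signature) on the `T` copies of the
public key; its outcome is the forged signature of `t`. -/
abbrev Attack (S d T : ℕ) (s t : Fin S) : Type :=
  Signature S d s → Povm (Fin T → Fin d) (Signature S d t)

/-- The per-qudit error probability `J` of the attack: for a uniformly random private key `k`, the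
probability that the verification of the forged signature on `|μ(k)⟩` gives the outcome `0`. -/
def errorProb {S d T : ℕ} {s t : Fin S} (A : Attack S d T s t) : ℝ :=
  (1 / 2 ^ d) * ∑ k : Fin d → Bool, ∑ κ : Signature S d t,
    (A (sign k s)).prob (copies T k) κ * probZero t κ k

/-- Binary entropy function, in bits. -/
def h (p : ℝ) : ℝ := p * Real.logb 2 (1 / p) + (1 - p) * Real.logb 2 (1 / (1 - p))

/-- The inverse of the restriction of `h` to `[0, 1/2]` (meaningful for arguments in `[0, 1]`). -/
def hInv (y : ℝ) : ℝ := Function.invFunOn h (Set.Icc 0 (1 / 2)) y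

/-- `α = 1 / S`. -/
def alpha (S : ℕ) : ℝ := 1 / S

/-- `φ = T (log₂ d) / d`. -/
def phi (d T : ℕ) : ℝ := T * Real.logb 2 d / d

/-- The bound `p₁` on the accept probability of a forged qudit. -/
def p1 (S d T : ℕ) : ℝ :=
  (1 - alpha S) *
    ((1 - alpha S / (1 - alpha S) * (2 * hInv (1 - phi d T / alpha S))) ^ 2 +
      Real.sqrt (8 / 3) *
        (Real.sqrt ((d : ℝ) - (revealedLength S d : ℝ)) / (revealedLength S d : ℝ)))

end QSig

end

/-!
The accept probability of a forged signature is the square of its correlation with the key, over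
the positions outside `I(t)`. These consist of `ℓ - m` positions known to the attacker, where
`m = d - ℓ`, and of the `m` positions of `I(s)`, whose bits must be guessed from the `T` copies.

A measurement of a state in dimension `n` assigns to an outcome at most the trace of its effect,
whatever the state, and these traces sum to `n`. Hence the exponential moment of a score of the
guess is at most `n = d ^ T` times its value for a guess made without the state, and Jensen's
inequality turns this into a bound on the mean score. For the correlation itself the moments are
powers of `cosh`, and optimising the parameter by Legendre duality bounds the mean correlation by
`m w`, where `w = 1 - 2 h⁻¹(1 - φ / α)` solves `T log d = m * rate w`. For the square of the
correlation one scores with `rate` instead, which is convex as a function of the square; counting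
strings by their number of errors bounds the moment by `m + 1`. The loss `2 m log (m + 1)` that this
causes is at most `√(8 / 3) * √m * ℓ`, the error term of the bound.
-/

open Real

open scoped BigOperators InnerProductSpace ComplexOrder Finset

noncomputable section

namespace QSig

section Rate

/-- The Cramér rate function of a fair random sign (in nats): the Legendre transform of
`r ↦ log (cosh r)`. It measures how unlikely a given average of independent fair signs is. -/
def rate (y : ℝ) : ℝ := log 2 - binEntropy ((1 - y) / 2)

lemma continuous_rate : Continuous rate := by
  unfold rate
  fun_prop

lemma rate_neg (y : ℝ) : rate (-y) = rate y := by
  rw [rate, rate, ← binEntropy_one_sub]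
  ring_nf

lemma rate_abs (y : ℝ) : rate |y| = rate y := by
  rcases abs_choice y with h | h <;> simp only [h, rate_neg]

lemma artanh_eq_half_log_sub_log {y : ℝ} (hy : y ∈ Set.Ioo (-1) 1) :
    artanh y = (log (1 + y) - log (1 - y)) / 2 := by
  rw [artanh_eq_half_log (Set.Ioo_subset_Icc_self hy),
    log_div (by linarith [hy.1]) (by linarith [hy.2])]
  ring

lemma hasSum_artanh_div_self {y : ℝ} (hy : y ∈ Set.Ioo 0 1) :
    HasSum (fun k : ℕ => y ^ (2 * k) / (2 * k + 1)) (artanh y / y) := by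
  have hlog := hasSum_log_sub_log_of_abs_lt_one (abs_lt.mpr ⟨by linarith [hy.1], hy.2⟩)
  rw [artanh_eq_half_log_sub_log ⟨by linarith [hy.1], hy.2⟩, div_div]
  refine (hlog.div_const (2 * y)).congr_fun fun k => ?_
  have := hy.1.ne'
  field_simp
  ring

lemma monotoneOn_artanh_div_self : MonotoneOn (fun y => artanh y / y) (Set.Ioo 0 1) :=
  fun x hx y hy hxy => hasSum_le
    (fun k => by have := hx.1.le; gcongr) (hasSum_artanh_div_self hx) (hasSum_artanh_div_self hy)

lemma self_le_artanh {y : ℝ} (hy : y ∈ Set.Ico 0 1) : y ≤ artanh y := by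
  rcases hy.1.eq_or_lt with rfl | hy0
  · rw [artanh_zero]
  · have hone : 1 ≤ artanh y / y := by
      simpa using le_hasSum (hasSum_artanh_div_self ⟨hy0, hy.2⟩) 0 fun k _ => by positivity
    rwa [one_le_div hy0] at hone

lemma hasDerivAt_rate {y : ℝ} (hy : y ∈ Set.Ioo (-1) 1) : HasDerivAt rate (artanh y) y := by
  obtain ⟨hy1, hy2⟩ := hy
  have hinner : HasDerivAt (fun y : ℝ => (1 - y) / 2) (-1 / 2) y :=
    ((hasDerivAt_id y).const_sub 1).div_const 2
  have houter := hasDerivAt_binEntropy (p := (1 - y) / 2) (by linarith) (by linarith)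
  refine ((houter.comp y hinner).const_sub (log 2)).congr_deriv ?_
  rw [artanh_eq_half_log_sub_log ⟨hy1, hy2⟩, show 1 - (1 - y) / 2 = (1 + y) / 2 by ring,
    log_div (by linarith) two_ne_zero, log_div (by linarith) two_ne_zero]
  ring

lemma monotoneOn_rate_sub_sq_half : MonotoneOn (fun y => rate y - y ^ 2 / 2) (Set.Icc 0 1) := by
  have hderiv : ∀ y ∈ Set.Ioo (0 : ℝ) 1,
      HasDerivAt (fun y => rate y - y ^ 2 / 2) (artanh y - y) y := fun y hy =>
    ((hasDerivAt_rate ⟨by linarith [hy.1], hy.2⟩).sub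
      ((hasDerivAt_pow 2 y).div_const 2)).congr_deriv (by ring)
  refine monotoneOn_of_hasDerivWithinAt_nonneg (f' := fun y => artanh y - y)
    (convex_Icc 0 1) (continuous_rate.sub (by fun_prop)).continuousOn
    (fun y hy => ?_) (fun y hy => ?_) <;> rw [interior_Icc] at hy
  · exact (hderiv y hy).hasDerivWithinAt
  · exact sub_nonneg.mpr (self_le_artanh ⟨hy.1.le, hy.2⟩)

lemma sq_le_of_rate_le {y w ε : ℝ} (hy : y ∈ Set.Icc 0 1) (hw : w ∈ Set.Icc 0 1) (hε : 0 ≤ ε)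
    (h : rate y ≤ rate w + ε) : y ^ 2 ≤ w ^ 2 + 2 * ε := by
  rcases le_total y w with hyw | hwy
  · linarith [pow_le_pow_left₀ hy.1 hyw 2]
  · linarith [monotoneOn_rate_sub_sq_half hw hy hwy]

lemma convexOn_rate_sqrt : ConvexOn ℝ (Set.Icc 0 1) fun u => rate √u := by
  have hmem : ∀ u ∈ Set.Ioo (0 : ℝ) 1, √u ∈ Set.Ioo 0 1 := fun u hu =>
    ⟨sqrt_pos.mpr hu.1, (sqrt_lt_sqrt hu.1.le hu.2).trans_eq sqrt_one⟩
  have hderiv : ∀ u ∈ Set.Ioo (0 : ℝ) 1,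
      HasDerivAt (fun u => rate √u) (artanh √u / √u / 2) u := fun u hu => by
    obtain ⟨hpos, hlt⟩ := hmem u hu
    refine ((hasDerivAt_rate ⟨by linarith, hlt⟩).comp u (hasDerivAt_sqrt hu.1.ne')).congr_deriv ?_
    ring
  refine MonotoneOn.convexOn_of_deriv (convex_Icc 0 1)
    (continuous_rate.comp continuous_sqrt).continuousOn ?_ ?_ <;> rw [interior_Icc]
  · exact fun u hu => (hderiv u hu).differentiableAt.differentiableWithinAt
  · intro u hu v hv huv
    rw [(hderiv u hu).deriv, (hderiv v hv).deriv]
    have := monotoneOn_artanh_div_self (hmem u hu) (hmem v hv) (sqrt_le_sqrt huv)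
    dsimp only at this
    linarith

lemma log_cosh_artanh {w : ℝ} (hw : w ∈ Set.Ioo (-1) 1) :
    log (cosh (artanh w)) = w * artanh w - rate w := by
  obtain ⟨hw1, hw2⟩ := hw
  rw [cosh_artanh ⟨hw1, hw2⟩, one_div, log_inv, log_sqrt (by nlinarith),
    show 1 - w ^ 2 = (1 + w) * (1 - w) by ring, log_mul (by linarith) (by linarith),
    artanh_eq_half_log_sub_log ⟨hw1, hw2⟩, rate, binEntropy,
    show 1 - (1 - w) / 2 = (1 + w) / 2 by ring, log_inv, log_inv,
    log_div (by linarith) two_ne_zero, log_div (by linarith) two_ne_zero]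
  ring

/-- Only the parameters `r = artanh w'` with `w < w' < x` are needed, since `artanh w'` is the slope
of the supporting line of `rate` at `w'`. -/
lemma le_of_forall_mul_le_rate_add_log_cosh {x w : ℝ} (hx : x ≤ 1) (hw : 0 ≤ w)
    (h : ∀ r, r * x ≤ rate w + log (cosh r)) : x ≤ w := by
  by_contra! hwx
  obtain ⟨w', hww', hw'x⟩ := exists_between hwx
  have hw' : 0 < w' ∧ w' < 1 := ⟨by linarith, by linarith⟩
  have hmono : rate w ≤ rate w' := by
    have := monotoneOn_rate_sub_sq_half ⟨hw, by linarith⟩ ⟨hw'.1.le, hw'.2.le⟩ hww'.le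
    dsimp only at this
    linarith [pow_le_pow_left₀ hw hww'.le 2]
  have htangent : artanh w' * x ≤ artanh w' * w' := by
    linarith [h (artanh w'), log_cosh_artanh ⟨by linarith, hw'.2⟩]
  exact absurd (le_of_mul_le_mul_left htangent (artanh_pos hw')) hw'x.not_ge

end Rate

section Logarithm

lemma log_natCast_le_of_pow_le_two_pow {n a b : ℕ} (hn : n ≠ 0) (hb : 0 < b) (h : n ^ b ≤ 2 ^ a) :
    log n ≤ a / b * log 2 := by
  have hlog : log ((n : ℝ) ^ b) ≤ log ((2 : ℝ) ^ a) :=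
    log_le_log (by positivity) (by exact_mod_cast h)
  rw [log_pow, log_pow] at hlog
  rw [div_mul_eq_mul_div, le_div_iff₀ (by positivity)]
  linarith

lemma sq_log_succ_le_of_pow_le_two_pow {m a b : ℕ} (hb : 0 < b) (hpow : (m + 1) ^ b ≤ 2 ^ a)
    (hab : 8 * a ^ 2 ≤ 11 * (b ^ 2 * m)) : log ((m : ℝ) + 1) ^ 2 ≤ 2 / 3 * m := by
  have hab' : (8 : ℝ) * a ^ 2 ≤ 11 * (b ^ 2 * m) := by exact_mod_cast hab
  have hlog := log_natCast_le_of_pow_le_two_pow m.succ_ne_zero hb hpow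
  push_cast at hlog
  calc log ((m : ℝ) + 1) ^ 2 ≤ (a / b * log 2) ^ 2 := by
        gcongr
        exact log_nonneg (by linarith [m.cast_nonneg (α := ℝ)])
    _ = log 2 ^ 2 * (a ^ 2 / b ^ 2) := by ring
    _ ≤ 0.4805 * (11 / 8 * m) := by
        gcongr
        · nlinarith [log_two_gt_d9, log_two_lt_d9]
        · rw [div_le_iff₀ (by positivity)]
          linarith
    _ ≤ 2 / 3 * m := by linarith [m.cast_nonneg (α := ℝ)]

lemma sq_log_succ_le_of_seven_le {m : ℕ} (hm : 7 ≤ m) : log ((m : ℝ) + 1) ^ 2 ≤ 2 / 3 * m := by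
  have hm' : (7 : ℝ) ≤ m := by exact_mod_cast hm
  have hlog8 : log 8 = 3 * log 2 := by
    rw [show (8 : ℝ) = 2 ^ 3 by norm_num, log_pow]
    norm_num
  have hexp : exp 2 ≤ 8 := by
    rw [← le_log_iff_exp_le (by norm_num)]
    linarith [log_two_gt_d9]
  have hanti : log (m + 1) / √(m + 1) ≤ log 8 / √8 :=
    log_div_sqrt_antitoneOn hexp (hexp.trans (by linarith)) (by linarith)
  have hsq := pow_le_pow_left₀ (div_nonneg (log_nonneg (by linarith)) (sqrt_nonneg _)) hanti 2
  rw [div_pow, div_pow, sq_sqrt (by positivity), sq_sqrt (by norm_num), hlog8,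
    div_le_iff₀ (by positivity)] at hsq
  calc log ((m : ℝ) + 1) ^ 2 ≤ 9 / 8 * log 2 ^ 2 * ((m : ℝ) + 1) := by linarith
    _ ≤ 9 / 8 * 0.4805 * ((m : ℝ) + 1) := by
        gcongr
        nlinarith [log_two_gt_d9, log_two_lt_d9]
    _ ≤ 2 / 3 * (m : ℝ) := by linarith

lemma sq_log_succ_le (m : ℕ) : log ((m : ℝ) + 1) ^ 2 ≤ 2 / 3 * m := by
  rcases lt_or_ge m 7 with hm | hm
  · -- The exponents below witness rational upper bounds `a / b` for `log₂ (m + 1)`.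
    interval_cases m
    · simp
    · exact sq_log_succ_le_of_pow_le_two_pow (a := 1) (b := 1) one_pos (by norm_num) (by norm_num)
    · exact sq_log_succ_le_of_pow_le_two_pow (a := 8) (b := 5) (by norm_num) (by norm_num)
        (by norm_num)
    · exact sq_log_succ_le_of_pow_le_two_pow (a := 2) (b := 1) one_pos (by norm_num) (by norm_num)
    · exact sq_log_succ_le_of_pow_le_two_pow (a := 7) (b := 3) (by norm_num) (by norm_num)
        (by norm_num)
    · exact sq_log_succ_le_of_pow_le_two_pow (a := 13) (b := 5) (by norm_num) (by norm_num)
        (by norm_num)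
    · exact sq_log_succ_le_of_pow_le_two_pow (a := 17) (b := 6) (by norm_num) (by norm_num)
        (by norm_num)
  · exact sq_log_succ_le_of_seven_le hm

lemma two_mul_log_succ_le (m : ℕ) : 2 * log (m + 1) ≤ √(8 / 3) * √m := by
  rw [← sqrt_mul (by norm_num)]
  apply le_sqrt_of_sq_le
  linarith [sq_log_succ_le m]

lemma two_mul_mul_log_succ_le {m : ℕ} {x : ℝ} (hx : m ≤ x) :
    2 * m * log (m + 1) ≤ √(8 / 3) * √m * x := by
  rw [mul_right_comm]
  exact mul_le_mul (two_mul_log_succ_le m) hx m.cast_nonneg (by positivity)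

end Logarithm

section Measurement

variable {n Ω : Type} [Fintype n] [Fintype Ω]

lemma star_dotProduct_self (v : EuclideanSpace ℂ n) : star v.ofLp ⬝ᵥ v.ofLp = (‖v‖ : ℂ) ^ 2 := by
  rw [dotProduct_comm, ← EuclideanSpace.inner_eq_star_dotProduct, inner_self_eq_norm_sq_to_K]
  rfl

lemma re_trace_nonneg {E : Matrix n n ℂ} (hE : E.PosSemidef) : 0 ≤ E.trace.re :=
  (Complex.nonneg_iff.mp hE.trace_nonneg).1

/-- The difference is the trace of `(1 - P)ᴴ * E * (1 - P)`, where `P` projects onto `v`. -/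
lemma re_dotProduct_mulVec_le_trace {E : Matrix n n ℂ} (hE : E.PosSemidef)
    {v : EuclideanSpace ℂ n} (hv : ‖v‖ = 1) :
    (star v.ofLp ⬝ᵥ E.mulVec v.ofLp).re ≤ E.trace.re := by
  classical
  set P : Matrix n n ℂ := Matrix.vecMulVec v.ofLp (star v.ofLp) with hP
  have hPP : P * P = P := by
    rw [hP, Matrix.vecMulVec_mul_vecMulVec, star_dotProduct_self, hv]
    simp
  have hconj : (1 - P).conjTranspose = 1 - P := by simp [hP, Matrix.conjTranspose_vecMulVec]
  have hidem : (1 - P) * (1 - P) = 1 - P := by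
    rw [sub_mul, one_mul, mul_sub, mul_one, hPP, sub_self, sub_zero]
  have htrace : (E * P).trace = star v.ofLp ⬝ᵥ E.mulVec v.ofLp := by
    rw [hP, Matrix.mul_vecMulVec, Matrix.trace_vecMulVec, dotProduct_comm]
  have hnonneg := re_trace_nonneg (hE.conjTranspose_mul_mul_same (1 - P))
  rw [hconj, Matrix.trace_mul_cycle, hidem, Matrix.trace_mul_comm, mul_sub, mul_one,
    Matrix.trace_sub, htrace, Complex.sub_re] at hnonneg
  linarith

variable [DecidableEq n]

lemma Povm.prob_nonneg (M : Povm n Ω) (v : EuclideanSpace ℂ n) (ω : Ω) : 0 ≤ M.prob v ω :=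
  (Complex.nonneg_iff.mp ((M.posSemidef ω).dotProduct_mulVec_nonneg v.ofLp)).1

lemma Povm.prob_le_trace (M : Povm n Ω) {v : EuclideanSpace ℂ n} (hv : ‖v‖ = 1) (ω : Ω) :
    M.prob v ω ≤ (M.effect ω).trace.re :=
  re_dotProduct_mulVec_le_trace (M.posSemidef ω) hv

lemma Povm.sum_prob (M : Povm n Ω) {v : EuclideanSpace ℂ n} (hv : ‖v‖ = 1) :
    ∑ ω, M.prob v ω = 1 := by
  simp only [Povm.prob]
  rw [← Complex.re_sum, ← dotProduct_sum, ← Matrix.sum_mulVec, M.sum_eq_one, Matrix.one_mulVec,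
    star_dotProduct_self, hv]
  simp

lemma Povm.sum_trace (M : Povm n Ω) : ∑ ω, (M.effect ω).trace.re = Fintype.card n := by
  rw [← Complex.re_sum, ← Matrix.trace_sum, M.sum_eq_one, Matrix.trace_one, Complex.natCast_re]

end Measurement

section OutcomeMean

variable {𝒦 : Type*} {n Ω : Type} [Fintype 𝒦] [Fintype n] [DecidableEq n] [Fintype Ω]

/-- The expectation of `g k ω` when `k` is uniformly random and `ω` is the outcome of the
measurement `M k` on the state `ψ k`. -/
def outcomeMean (M : 𝒦 → Povm n Ω) (ψ : 𝒦 → EuclideanSpace ℂ n) (g : 𝒦 → Ω → ℝ) : ℝ :=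
  𝔼 k, ∑ ω, (M k).prob (ψ k) ω * g k ω

variable {M : 𝒦 → Povm n Ω} {ψ : 𝒦 → EuclideanSpace ℂ n} {g : 𝒦 → Ω → ℝ}

lemma outcomeMean_mono {g' : 𝒦 → Ω → ℝ} (hg : ∀ k ω, g k ω ≤ g' k ω) :
    outcomeMean M ψ g ≤ outcomeMean M ψ g' :=
  Finset.expect_le_expect fun k _ => Finset.sum_le_sum fun ω _ =>
    mul_le_mul_of_nonneg_left (hg k ω) ((M k).prob_nonneg _ _)

lemma outcomeMean_add (g g' : 𝒦 → Ω → ℝ) :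
    outcomeMean M ψ (fun k ω => g k ω + g' k ω) = outcomeMean M ψ g + outcomeMean M ψ g' := by
  simp only [outcomeMean, mul_add, Finset.sum_add_distrib, Finset.expect_add_distrib]

lemma outcomeMean_const_mul (c : ℝ) (g : 𝒦 → Ω → ℝ) :
    outcomeMean M ψ (fun k ω => c * g k ω) = c * outcomeMean M ψ g := by
  simp only [outcomeMean, mul_left_comm _ c, ← Finset.mul_sum, ← Finset.mul_expect]

lemma outcomeMean_eq_sum (g : 𝒦 → Ω → ℝ) : outcomeMean M ψ g =
    ∑ x : 𝒦 × Ω, ((Fintype.card 𝒦 : ℝ)⁻¹ * (M x.1).prob (ψ x.1) x.2) • g x.1 x.2 := by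
  simp only [outcomeMean, Fintype.expect_eq_sum_div_card, Fintype.sum_prod_type, smul_eq_mul,
    mul_assoc, ← Finset.mul_sum, div_eq_inv_mul]

variable [Nonempty 𝒦]

lemma outcomeMean_const (hψ : ∀ k, ‖ψ k‖ = 1) (c : ℝ) : outcomeMean M ψ (fun _ _ => c) = c := by
  simp only [outcomeMean, ← Finset.sum_mul, Povm.sum_prob _ (hψ _), one_mul, Fintype.expect_const]

lemma outcomeMean_mem_Icc (hψ : ∀ k, ‖ψ k‖ = 1) {a b : ℝ} (hg : ∀ k ω, g k ω ∈ Set.Icc a b) :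
    outcomeMean M ψ g ∈ Set.Icc a b :=
  ⟨(outcomeMean_const hψ a).symm.trans_le (outcomeMean_mono fun k ω => (hg k ω).1),
    (outcomeMean_mono fun k ω => (hg k ω).2).trans_eq (outcomeMean_const hψ b)⟩

lemma map_outcomeMean_le {s : Set ℝ} {f : ℝ → ℝ} (hf : ConvexOn ℝ s f)
    (hψ : ∀ k, ‖ψ k‖ = 1) (hg : ∀ k ω, g k ω ∈ s) :
    f (outcomeMean M ψ g) ≤ outcomeMean M ψ fun k ω => f (g k ω) := by
  rw [outcomeMean_eq_sum, outcomeMean_eq_sum]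
  refine hf.map_sum_le (fun x _ => ?_) ?_ fun x _ => hg x.1 x.2
  · exact mul_nonneg (by positivity) ((M x.1).prob_nonneg _ _)
  · simpa only [outcomeMean_eq_sum, smul_eq_mul, mul_one] using outcomeMean_const (M := M) hψ 1

/-- Replacing the probabilities of the outcomes by the traces of the effects removes the dependence
on `ψ k`, after which `k` can be averaged over each fibre of `c`. -/
lemma outcomeMean_le_card_mul {Γ : Type*} [DecidableEq Γ] {M : Γ → Povm n Ω} {c : 𝒦 → Γ}
    {K : ℝ} (hψ : ∀ k, ‖ψ k‖ = 1) (hg0 : ∀ k ω, 0 ≤ g k ω)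
    (hg : ∀ γ ω, ∑ k with c k = γ, g k ω ≤ #{k | c k = γ} * K) :
    outcomeMean (fun k => M (c k)) ψ g ≤ Fintype.card n * K := by
  rw [outcomeMean, Fintype.expect_eq_sum_div_card, div_le_iff₀ (by positivity)]
  calc ∑ k, ∑ ω, (M (c k)).prob (ψ k) ω * g k ω
      ≤ ∑ k, ∑ ω, ((M (c k)).effect ω).trace.re * g k ω := by
        gcongr with k _ ω _
        · exact hg0 k ω
        · exact (M (c k)).prob_le_trace (hψ k) ω
    _ = ∑ γ ∈ Finset.univ.image c, ∑ k with c k = γ, ∑ ω, ((M γ).effect ω).trace.re * g k ω := by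
        rw [← Finset.sum_fiberwise_of_maps_to fun k hk => Finset.mem_image_of_mem c hk]
        refine Finset.sum_congr rfl fun γ _ => Finset.sum_congr rfl fun k hk => ?_
        rw [(Finset.mem_filter.mp hk).2]
    _ = ∑ γ ∈ Finset.univ.image c, ∑ ω, ((M γ).effect ω).trace.re * ∑ k with c k = γ, g k ω := by
        simp only [Finset.sum_comm (t := Finset.univ (α := Ω)), Finset.mul_sum]
    _ ≤ ∑ γ ∈ Finset.univ.image c, ∑ ω, ((M γ).effect ω).trace.re * (#{k | c k = γ} * K) := by
        gcongr with γ _ ω _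
        · exact re_trace_nonneg ((M γ).posSemidef ω)
        · exact hg γ ω
    _ = Fintype.card n * K * ∑ γ ∈ Finset.univ.image c, (#{k | c k = γ} : ℝ) := by
        simp only [← Finset.sum_mul, Povm.sum_trace, Finset.mul_sum]
        exact Finset.sum_congr rfl fun γ _ => by ring
    _ = Fintype.card n * K * Fintype.card 𝒦 := by
        rw [← Nat.cast_sum, ← Finset.card_eq_sum_card_image, Finset.card_univ]

/-- Measuring a state in dimension `n` instead of guessing costs at most a factor `n` in the
exponential moment. -/
lemma outcomeMean_le_log_card_add_log {Γ : Type*} [DecidableEq Γ] {M : Γ → Povm n Ω} {c : 𝒦 → Γ}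
    {K : ℝ} (hψ : ∀ k, ‖ψ k‖ = 1) (hK : 0 < K)
    (hg : ∀ γ ω, ∑ k with c k = γ, exp (g k ω) ≤ #{k | c k = γ} * K) :
    outcomeMean (fun k => M (c k)) ψ g ≤ log (Fintype.card n) + log K := by
  have hexp : exp (outcomeMean (fun k => M (c k)) ψ g) ≤ Fintype.card n * K :=
    (map_outcomeMean_le convexOn_exp hψ fun _ _ => Set.mem_univ _).trans
      (outcomeMean_le_card_mul hψ (fun _ _ => (exp_pos _).le) hg)
  have hcard : (Fintype.card n : ℝ) ≠ 0 := left_ne_zero_of_mul ((exp_pos _).trans_le hexp).ne'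
  rw [← log_mul hcard hK.ne']
  exact (le_log_iff_exp_le (by positivity)).mpr hexp

end OutcomeMean

section Agreement

variable {ι : Type*}

/-- The sign `(-1) ^ b`. -/
def bitSign (b : Bool) : ℝ := if b then -1 else 1

/-- The correlation of the signs of two bit strings over the positions in `I`: the number of
positions of `I` where they agree, minus the number of those where they differ. -/
def agreement (I : Finset ι) (x y : ι → Bool) : ℝ := ∑ j ∈ I, bitSign (x j) * bitSign (y j)

lemma bitSign_mul_self (b : Bool) : bitSign b * bitSign b = 1 := by cases b <;> simp [bitSign]

lemma bitSign_not (b : Bool) : bitSign (!b) = -bitSign b := by cases b <;> simp [bitSign]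

lemma agreement_eq (I : Finset ι) (x y : ι → Bool) :
    agreement I x y = #I - 2 * #{j ∈ I | y j ≠ x j} := by
  have hsign : ∀ b c : Bool, bitSign b * bitSign c = 1 - 2 * if c ≠ b then (1 : ℝ) else 0 := by
    intro b c; cases b <;> cases c <;> norm_num [bitSign]
  simp only [agreement, hsign, Finset.sum_sub_distrib, ← Finset.mul_sum, Finset.sum_boole]
  simp

lemma abs_agreement_le (I : Finset ι) (x y : ι → Bool) : |agreement I x y| ≤ #I := by
  have hcard : (#{j ∈ I | y j ≠ x j} : ℝ) ≤ #I := by exact_mod_cast Finset.card_filter_le _ _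
  rw [agreement_eq, abs_le]
  constructor <;> linarith [(#{j ∈ I | y j ≠ x j}).cast_nonneg (α := ℝ)]

lemma mul_agreement_le (I : Finset ι) {c : ℝ} (hc : |c| ≤ 1) (x y : ι → Bool) :
    c * agreement I x y ≤ #I := by
  calc c * agreement I x y ≤ |c| * |agreement I x y| := (le_abs_self _).trans_eq (abs_mul _ _)
    _ ≤ 1 * #I := by
        gcongr
        exact abs_agreement_le I x y
    _ = #I := one_mul _

/-- The restriction of a bit string to the positions outside `I`. -/
def revealed (I : Finset ι) (k : ι → Bool) : {j // j ∉ I} → Bool := fun j => k j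

/-- The bit string that agrees with `σ` outside `I` and, by convention, vanishes on `I`. -/
def completion {I : Finset ι} (σ : {j // j ∉ I} → Bool) : ι → Bool :=
  Function.extend Subtype.val σ fun _ => false

lemma completion_apply {I : Finset ι} (σ : {j // j ∉ I} → Bool) {j : ι} (hj : j ∉ I) :
    completion σ j = σ ⟨j, hj⟩ :=
  Subtype.val_injective.extend_apply σ _ ⟨j, hj⟩

variable [DecidableEq ι]

lemma agreement_eq_agreement_sdiff_add {I J : Finset ι} (hIJ : I ⊆ J) (x k : ι → Bool) :
    agreement J x k = agreement (J \ I) x (completion (revealed I k)) + agreement I x k := by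
  rw [agreement, ← Finset.sum_sdiff hIJ]
  congr 1
  refine Finset.sum_congr rfl fun j hj => ?_
  rw [completion_apply _ (Finset.mem_sdiff.mp hj).2, revealed]

variable [Fintype ι]

/-- A string with prescribed bits outside `I` is determined by the set of positions of `I` where it
differs from `x`. -/
lemma sum_revealed_eq_sum_choose {R : Type*} [AddCommMonoid R] (I : Finset ι)
    (σ : {j // j ∉ I} → Bool) (x : ι → Bool) (f : ℕ → R) :
    ∑ k with revealed I k = σ, f #{j ∈ I | k j ≠ x j} =
      ∑ D ∈ Finset.range (#I + 1), (#I).choose D • f D := by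
  rw [← Finset.sum_powerset_apply_card]
  refine Finset.sum_nbij' (fun k => {j ∈ I | k j ≠ x j})
    (fun D j => if hj : j ∈ I then (if j ∈ D then !x j else x j) else σ ⟨j, hj⟩)
    (fun k _ => Finset.mem_powerset.mpr (Finset.filter_subset _ _)) (fun D _ => ?_)
    (fun k hk => ?_) (fun D hD => ?_) fun _ _ => rfl
  · simp only [Finset.mem_filter_univ]
    ext j
    simp [revealed, j.2]
  · obtain rfl := (Finset.mem_filter.mp hk).2
    ext j
    by_cases hj : j ∈ I
    · by_cases hx : k j = x j
      · simp [hj, hx]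
      · simpa [hj, hx] using Bool.eq_not.mpr (Ne.symm hx)
    · simp [hj, revealed]
  · ext j
    by_cases hj : j ∈ D
    · simp [hj, Finset.mem_powerset.mp hD hj]
    · simp +contextual [hj]

lemma card_revealed_eq (I : Finset ι) (σ : {j // j ∉ I} → Bool) :
    #{k | revealed I k = σ} = 2 ^ #I := by
  rw [Finset.card_eq_sum_ones, sum_revealed_eq_sum_choose I σ (fun _ => false) fun _ => 1]
  simp [Nat.sum_range_choose]

lemma sum_exp_mul_agreement (I : Finset ι) (σ : {j // j ∉ I} → Bool) (x : ι → Bool) (r : ℝ) :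
    ∑ k with revealed I k = σ, exp (r * agreement I x k) =
      #{k | revealed I k = σ} * cosh r ^ #I := by
  simp only [agreement_eq]
  rw [sum_revealed_eq_sum_choose I σ x fun D => exp (r * (#I - 2 * D)), card_revealed_eq,
    Nat.cast_pow, ← mul_pow, Nat.cast_two, cosh_eq, mul_div_cancel₀ _ two_ne_zero,
    add_comm (exp r), add_pow]
  refine Finset.sum_congr rfl fun D hD => ?_
  rw [nsmul_eq_mul, mul_comm, ← exp_nat_mul, ← exp_nat_mul, ← exp_add,
    Nat.cast_sub (Finset.mem_range_succ_iff.mp hD)]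
  ring_nf

lemma pow_eq_exp_mul_log {p : ℝ} {D : ℕ} (hp : 0 ≤ p) (h : p = 0 → D = 0) :
    p ^ D = exp (D * log p) := by
  rcases hp.eq_or_lt with rfl | hp
  · simp [h rfl]
  · rw [exp_nat_mul, exp_log hp]

/-- A single term of the binomial distribution with parameter `D / m` is at most one. -/
lemma choose_le_exp_binEntropy (m D : ℕ) : (m.choose D : ℝ) ≤ exp (m * binEntropy (D / m)) := by
  rcases lt_or_ge m D with hlt | hD
  · rw [Nat.choose_eq_zero_of_lt hlt]
    exact_mod_cast (exp_pos _).le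
  rcases m.eq_zero_or_pos with rfl | hm
  · simp [Nat.le_zero.mp hD]
  have hm' : (0 : ℝ) < m := by exact_mod_cast hm
  have hD' : (D : ℝ) ≤ m := by exact_mod_cast hD
  have hp0 : (0 : ℝ) ≤ D / m := by positivity
  have hp1 : (0 : ℝ) ≤ 1 - D / m := sub_nonneg.mpr ((div_le_one hm').mpr hD')
  have hmp : m * (D / m : ℝ) = D := mul_div_cancel₀ _ hm'.ne'
  generalize (D : ℝ) / m = p at hp0 hp1 hmp ⊢
  have hprob : p ^ D * (1 - p) ^ (m - D) = exp (-(m * binEntropy p)) := by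
    rw [pow_eq_exp_mul_log hp0 fun h => by simpa [h] using hmp.symm,
      pow_eq_exp_mul_log hp1 fun h => ?_, ← exp_add, Nat.cast_sub hD, ← hmp, binEntropy, log_inv,
      log_inv]
    · ring_nf
    · rw [← Nat.cast_eq_zero (R := ℝ), Nat.cast_sub hD]
      linear_combination (m : ℝ) * h + hmp
  have hsum : p ^ D * (1 - p) ^ (m - D) * m.choose D ≤ 1 := by
    calc _ ≤ (p + (1 - p)) ^ m := by
          rw [add_pow]
          exact Finset.single_le_sum (f := fun i => p ^ i * (1 - p) ^ (m - i) * (m.choose i : ℝ))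
            (fun i _ => by positivity) (Finset.mem_range_succ_iff.mpr hD)
      _ = 1 := by rw [add_sub_cancel, one_pow]
  rwa [hprob, exp_neg, inv_mul_le_iff₀ (exp_pos _), mul_one] at hsum

lemma natCast_mul_rate (m D : ℕ) :
    m * rate ((m - 2 * D) / m) = m * log 2 - m * binEntropy (D / m) := by
  rcases m.eq_zero_or_pos with rfl | hm
  · simp
  · rw [rate, show (1 - ((m : ℝ) - 2 * D) / m) / 2 = D / m by field_simp; ring, mul_sub]

lemma sum_exp_mul_rate_agreement_le (I : Finset ι) (σ : {j // j ∉ I} → Bool) (x : ι → Bool) :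
    ∑ k with revealed I k = σ, exp (#I * rate (agreement I x k / #I)) ≤
      #{k | revealed I k = σ} * (#I + 1) := by
  simp only [agreement_eq, natCast_mul_rate]
  rw [sum_revealed_eq_sum_choose I σ x fun D => exp (#I * log 2 - #I * binEntropy (D / #I)),
    card_revealed_eq]
  have hterm : ∀ D ∈ Finset.range (#I + 1),
      (#I).choose D • exp (#I * log 2 - #I * binEntropy (D / #I)) ≤ (2 : ℝ) ^ #I := fun D _ => by
    rw [nsmul_eq_mul, exp_sub, exp_nat_mul, exp_log two_pos, mul_div_left_comm]
    exact mul_le_of_le_one_right (by positivity)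
      ((div_le_one (exp_pos _)).mpr (choose_le_exp_binEntropy _ D))
  refine (Finset.sum_le_card_nsmul _ _ _ hterm).trans_eq ?_
  rw [Finset.card_range, nsmul_eq_mul]
  push_cast
  ring

end Agreement

section Guessing

variable {ι : Type*} [Fintype ι] [DecidableEq ι] {n Ω : Type} [Fintype n] [DecidableEq n]
  [Fintype Ω] {I : Finset ι} {M : ({j // j ∉ I} → Bool) → Povm n Ω}
  {ψ : (ι → Bool) → EuclideanSpace ℂ n} {w : ℝ}

lemma outcomeMean_mul_agreement_le (hψ : ∀ k, ‖ψ k‖ = 1)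
    (hn : log (Fintype.card n) ≤ #I * rate w) (hw : 0 ≤ w)
    {c : ({j // j ∉ I} → Bool) → Ω → ℝ} (hc : ∀ σ ω, |c σ ω| ≤ 1) (x : Ω → ι → Bool) :
    outcomeMean (fun k => M (revealed I k)) ψ
      (fun k ω => c (revealed I k) ω * agreement I (x ω) k) ≤ #I * w := by
  set E := outcomeMean (fun k => M (revealed I k)) ψ
    (fun k ω => c (revealed I k) ω * agreement I (x ω) k) with hE
  have hE_le : E ≤ #I :=
    (outcomeMean_mono fun k ω => mul_agreement_le I (hc _ ω) (x ω) k).trans_eq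
      (outcomeMean_const hψ _)
  rcases (#I).eq_zero_or_pos with hI | hI
  · simpa [hI] using hE_le
  have hI' : (0 : ℝ) < #I := by exact_mod_cast hI
  have hexp : ∀ r : ℝ, r * E ≤ log (Fintype.card n) + #I * log (cosh r) := by
    intro r
    rw [hE, ← outcomeMean_const_mul, ← log_pow]
    refine outcomeMean_le_log_card_add_log hψ (pow_pos (cosh_pos r) _) fun σ ω => ?_
    calc ∑ k with revealed I k = σ, exp (r * (c (revealed I k) ω * agreement I (x ω) k))
        = ∑ k with revealed I k = σ, exp (r * c σ ω * agreement I (x ω) k) :=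
          Finset.sum_congr rfl fun k hk => by rw [(Finset.mem_filter.mp hk).2, mul_assoc]
      _ = #{k | revealed I k = σ} * cosh (r * c σ ω) ^ #I := sum_exp_mul_agreement I σ _ _
      _ ≤ #{k | revealed I k = σ} * cosh r ^ #I := by
          gcongr
          rw [cosh_le_cosh, abs_mul]
          exact mul_le_of_le_one_right (abs_nonneg r) (hc σ ω)
  rw [mul_comm, ← div_le_iff₀ hI']
  refine le_of_forall_mul_le_rate_add_log_cosh ((div_le_one hI').mpr hE_le) hw fun r => ?_
  rw [← mul_div_assoc, div_le_iff₀ hI']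
  linarith [hexp r]

lemma outcomeMean_rate_agreement_le (hψ : ∀ k, ‖ψ k‖ = 1) (x : Ω → ι → Bool) :
    #I * outcomeMean (fun k => M (revealed I k)) ψ
      (fun k ω => rate (agreement I (x ω) k / #I)) ≤ log (Fintype.card n) + log (#I + 1) := by
  rw [← outcomeMean_const_mul]
  exact outcomeMean_le_log_card_add_log hψ (by positivity) fun σ ω =>
    sum_exp_mul_rate_agreement_le I σ (x ω)

lemma outcomeMean_sq_agreement_le (hψ : ∀ k, ‖ψ k‖ = 1)
    (hn : log (Fintype.card n) ≤ #I * rate w) (hw : w ∈ Set.Icc 0 1)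
    (x : Ω → ι → Bool) :
    outcomeMean (fun k => M (revealed I k)) ψ (fun k ω => agreement I (x ω) k ^ 2) ≤
      (#I * w) ^ 2 + 2 * #I * log (#I + 1) := by
  rcases I.eq_empty_or_nonempty with rfl | hI
  · simp [outcomeMean, agreement]
  have hI' : (0 : ℝ) < #I := by exact_mod_cast hI.card_pos
  set u := outcomeMean (fun k => M (revealed I k)) ψ (fun k ω => (agreement I (x ω) k / #I) ^ 2)
    with hu
  have hmem : ∀ k ω, (agreement I (x ω) k / #I) ^ 2 ∈ Set.Icc (0 : ℝ) 1 := fun k ω => by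
    refine ⟨sq_nonneg _, (sq_le_one_iff_abs_le_one _).mpr ?_⟩
    rw [abs_div, Nat.abs_cast]
    exact (div_le_one hI').mpr (abs_agreement_le I (x ω) k)
  have hu01 : u ∈ Set.Icc 0 1 := outcomeMean_mem_Icc hψ hmem
  have hjensen : rate √u ≤ outcomeMean (fun k => M (revealed I k)) ψ
      (fun k ω => rate (agreement I (x ω) k / #I)) := by
    simpa only [sqrt_sq_eq_abs, rate_abs] using
      map_outcomeMean_le convexOn_rate_sqrt (M := fun k => M (revealed I k)) hψ hmem
  have hrate : rate √u ≤ rate w + log (#I + 1) / #I := by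
    rw [← mul_le_mul_iff_right₀ hI', mul_add, mul_div_cancel₀ _ hI'.ne']
    linarith [mul_le_mul_of_nonneg_left hjensen hI'.le,
      outcomeMean_rate_agreement_le (M := M) hψ x]
  have hu_le : u ≤ w ^ 2 + 2 * (log (#I + 1) / #I) := by
    rw [← sq_sqrt hu01.1]
    exact sq_le_of_rate_le ⟨sqrt_nonneg u, sqrt_le_one.mpr hu01.2⟩ hw
      (div_nonneg (log_nonneg (by linarith)) hI'.le) hrate
  calc outcomeMean (fun k => M (revealed I k)) ψ (fun k ω => agreement I (x ω) k ^ 2)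
      = #I ^ 2 * u := by
        rw [hu, ← outcomeMean_const_mul]
        congr 1
        ext k ω
        field_simp
    _ ≤ #I ^ 2 * (w ^ 2 + 2 * (log (#I + 1) / #I)) := by gcongr
    _ = (#I * w) ^ 2 + 2 * #I * log (#I + 1) := by field_simp

/-- The mean square `E[(a + b)²] = E[a²] + 2 E[a b] + E[b²]` is bounded term by term, where `b` is
the agreement with the guess: the cross term has known coefficients, so it is a scaled guess. -/
lemma outcomeMean_sq_add_agreement_le (hψ : ∀ k, ‖ψ k‖ = 1)
    (hn : log (Fintype.card n) ≤ #I * rate w) (hw : w ∈ Set.Icc 0 1)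
    {B : ℝ} (hB : 0 ≤ B) {a : ({j // j ∉ I} → Bool) → Ω → ℝ} (ha : ∀ σ ω, |a σ ω| ≤ B)
    (x : Ω → ι → Bool) :
    outcomeMean (fun k => M (revealed I k)) ψ
      (fun k ω => (a (revealed I k) ω + agreement I (x ω) k) ^ 2) ≤
      (B + #I * w) ^ 2 + 2 * #I * log (#I + 1) := by
  have hscale : ∀ σ ω, B * (a σ ω / B) = a σ ω := fun σ ω =>
    mul_div_cancel_of_imp' fun h => abs_nonpos_iff.mp ((ha σ ω).trans_eq h)
  have hcoef : ∀ σ ω, |a σ ω / B| ≤ 1 := fun σ ω => by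
    rw [abs_div, abs_of_nonneg hB]
    exact div_le_one_of_le₀ (ha σ ω) hB
  have hpoint : ∀ k ω, (a (revealed I k) ω + agreement I (x ω) k) ^ 2 ≤
      B ^ 2 + (2 * B * (a (revealed I k) ω / B * agreement I (x ω) k) +
        agreement I (x ω) k ^ 2) := fun k ω => by
    linear_combination sq_le_sq' (abs_le.mp (ha (revealed I k) ω)).1 (abs_le.mp (ha _ ω)).2 -
      2 * agreement I (x ω) k * hscale (revealed I k) ω
  refine (outcomeMean_mono hpoint).trans ?_
  rw [outcomeMean_add, outcomeMean_add, outcomeMean_const hψ, outcomeMean_const_mul]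
  linarith [mul_le_mul_of_nonneg_left (outcomeMean_mul_agreement_le (M := M) hψ hn hw.1 hcoef x)
    (by linarith : 0 ≤ 2 * B), outcomeMean_sq_agreement_le (M := M) hψ hn hw x]

lemma outcomeMean_sq_agreement_le_of_subset (hψ : ∀ k, ‖ψ k‖ = 1)
    (hn : log (Fintype.card n) ≤ #I * rate w) (hw : w ∈ Set.Icc 0 1)
    {J : Finset ι} (hIJ : I ⊆ J) (x : Ω → ι → Bool) :
    outcomeMean (fun k => M (revealed I k)) ψ (fun k ω => agreement J (x ω) k ^ 2) ≤
      (#(J \ I) + #I * w) ^ 2 + 2 * #I * log (#I + 1) := by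
  simp only [agreement_eq_agreement_sdiff_add hIJ]
  exact outcomeMean_sq_add_agreement_le (a := fun σ ω => agreement (J \ I) (x ω) (completion σ))
    hψ hn hw (Nat.cast_nonneg _) (fun σ ω => abs_agreement_le _ _ _) x

end Guessing

section Protocol

lemma sum_bitSign_eq_zero {ι : Type*} [Fintype ι] [DecidableEq ι] {I : Finset ι}
    (σ : {j // j ∉ I} → Bool) {i : ι} (hi : i ∈ I) :
    ∑ k with revealed I k = σ, bitSign (k i) = 0 := by
  refine Finset.sum_involution (fun k _ => Function.update k i (!k i)) (fun k _ => ?_)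
    (fun k _ _ hk => ?_) (fun k hk => ?_) fun k _ => ?_
  · rw [Function.update_self, bitSign_not, add_neg_cancel]
  · simpa using congrFun hk i
  · obtain rfl := (Finset.mem_filter.mp hk).2
    refine (Finset.mem_filter_univ _).mpr (funext fun j => Function.update_of_ne ?_ _ _)
    exact fun hj => j.2 (hj ▸ hi)
  · simp

lemma sum_bitSign_of_notMem {ι : Type*} [Fintype ι] [DecidableEq ι] {I : Finset ι}
    (σ : {j // j ∉ I} → Bool) {i : ι} (hi : i ∉ I) :
    ∑ k with revealed I k = σ, bitSign (k i) = 2 ^ #I * bitSign (completion σ i) := by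
  have hconst : ∀ k ∈ Finset.univ.filter (fun k => revealed I k = σ),
      bitSign (k i) = bitSign (completion σ i) := fun k hk => by
    rw [completion_apply σ hi, ← (Finset.mem_filter.mp hk).2, revealed]
  rw [Finset.sum_congr rfl hconst, Finset.sum_const, card_revealed_eq, nsmul_eq_mul]
  norm_cast

/-- The vector of the signs of the bit string `x` at the positions in `I`, and zero elsewhere. The
fingerprinting states, and the states onto which the verifier projects, are multiples of such
vectors. -/
def signVector {ι : Type*} [DecidableEq ι] (I : Finset ι) (x : ι → Bool) : EuclideanSpace ℂ ι :=
  WithLp.toLp 2 fun j => if j ∈ I then (bitSign (x j) : ℂ) else 0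

lemma inner_signVector {ι : Type*} [Fintype ι] [DecidableEq ι] (I J : Finset ι) (x y : ι → Bool) :
    ⟪signVector I x, signVector J y⟫_ℂ = agreement (I ∩ J) x y := by
  simp only [PiLp.inner_apply, signVector, RCLike.inner_apply, agreement, Complex.ofReal_sum]
  rw [← Finset.sum_subset (Finset.subset_univ (I ∩ J))]
  · refine Finset.sum_congr rfl fun j hj => ?_
    simp [Finset.mem_inter.mp hj, mul_comm]
  · intro j _ hj
    by_cases hI : j ∈ I <;> simp_all

lemma norm_signVector_sq {ι : Type*} [Fintype ι] [DecidableEq ι] (I : Finset ι) (x : ι → Bool) :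
    ‖signVector I x‖ ^ 2 = #I := by
  rw [← inner_self_eq_norm_sq (𝕜 := ℂ), inner_signVector]
  simp [agreement, bitSign_mul_self]

variable {S d T : ℕ}

lemma fingerprint_eq (k : Fin d → Bool) :
    fingerprint k = ((√d)⁻¹ : ℂ) • signVector Finset.univ k := by
  ext j
  cases hk : k j <;> simp [fingerprint, signVector, bitSign, hk]

lemma norm_fingerprint (hd : 0 < d) (k : Fin d → Bool) : ‖fingerprint k‖ = 1 := by
  have hd' : (d : ℝ) ≠ 0 := by exact_mod_cast hd.ne'
  rw [← sq_eq_sq₀ (norm_nonneg _) zero_le_one, fingerprint_eq, norm_smul, mul_pow,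
    norm_signVector_sq]
  simp [hd']

lemma norm_copies (hd : 0 < d) (k : Fin d → Bool) : ‖copies T k‖ = 1 := by
  rw [← sq_eq_sq₀ (norm_nonneg _) zero_le_one, EuclideanSpace.norm_sq_eq]
  simp only [copies, norm_prod, ← Finset.prod_pow]
  rw [← Fintype.sum_pow (fun j => ‖fingerprint k j‖ ^ 2), ← EuclideanSpace.norm_sq_eq,
    norm_fingerprint hd, one_pow, one_pow]

lemma verifVector_eq (t : Fin S) (κ : Signature S d t) :
    verifVector t κ = ((2 ^ #(hidden S d t) / √d : ℝ) : ℂ) •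
      signVector (hidden S d t)ᶜ (completion κ) := by
  ext j
  have hcoord : verifVector t κ j =
      (((√d)⁻¹ * ∑ k with revealed (hidden S d t) k = κ, bitSign (k j) : ℝ) : ℂ) := by
    rw [verifVector, WithLp.ofLp_sum, Finset.sum_apply]
    push_cast
    rw [Finset.mul_sum]
    refine Finset.sum_congr rfl fun k _ => ?_
    simp [fingerprint_eq, signVector]
  by_cases hj : j ∈ hidden S d t
  · rw [hcoord, sum_bitSign_eq_zero κ hj]
    simp [signVector, hj]
  · rw [hcoord, sum_bitSign_of_notMem κ hj]
    simp [signVector, hj]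
    ring

lemma probOne_eq (hd : 0 < d) (t : Fin S) (κ : Signature S d t) (k : Fin d → Bool) :
    probOne t κ k =
      agreement (hidden S d t)ᶜ (completion κ) k ^ 2 / (d * #(hidden S d t)ᶜ) := by
  have hd' : (0 : ℝ) < d := by exact_mod_cast hd
  have hnum : ‖⟪verifVector t κ, fingerprint k⟫_ℂ‖ ^ 2 =
      (2 ^ #(hidden S d t) / d) ^ 2 * agreement (hidden S d t)ᶜ (completion κ) k ^ 2 := by
    have hfactor : 2 ^ #(hidden S d t) / √d * (√d)⁻¹ = 2 ^ #(hidden S d t) / d := by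
      rw [← div_eq_mul_inv, div_div, mul_self_sqrt hd'.le]
    rw [verifVector_eq, fingerprint_eq, inner_smul_left, inner_smul_right, inner_signVector,
      Finset.inter_univ, Complex.conj_ofReal, ← Complex.ofReal_inv, ← mul_assoc,
      ← Complex.ofReal_mul, hfactor, ← Complex.ofReal_mul, Complex.norm_real, norm_eq_abs, sq_abs,
      mul_pow]
  have hden : ‖verifVector t κ‖ ^ 2 = (2 ^ #(hidden S d t)) ^ 2 / d * #(hidden S d t)ᶜ := by
    rw [verifVector_eq, norm_smul, mul_pow, norm_signVector_sq, Complex.norm_real, norm_eq_abs,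
      sq_abs, div_pow, sq_sqrt hd'.le]
  rw [probOne, verifState, inner_smul_left, norm_mul, mul_pow, hnum, Complex.conj_ofReal,
    Complex.norm_real, norm_eq_abs, sq_abs, inv_pow, hden]
  field_simp

lemma one_sub_errorProb (hd : 0 < d) {s t : Fin S} (A : Attack S d T s t) :
    1 - errorProb A = outcomeMean (fun k => A (revealed (hidden S d s) k)) (copies T)
      fun k κ => probOne t κ k := by
  have herror : errorProb A = outcomeMean (fun k => A (revealed (hidden S d s) k)) (copies T)
      fun k κ => 1 + -1 * probOne t κ k := by
    simp only [errorProb, probZero, outcomeMean, Fintype.expect_eq_sum_div_card, sub_eq_add_neg,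
      neg_one_mul, Fintype.card_fun, Fintype.card_bool, Fintype.card_fin, one_div_mul_eq_div,
      Nat.cast_pow, Nat.cast_two]
    rfl
  rw [herror, outcomeMean_add, outcomeMean_const (norm_copies hd), outcomeMean_const_mul]
  ring

lemma disjoint_hidden {s t : Fin S} (hst : t ≠ s) : Disjoint (hidden S d s) (hidden S d t) := by
  rw [Finset.disjoint_left]
  intro j hs ht
  simp only [hidden, Finset.mem_filter_univ] at hs ht
  wlog h : (t : ℕ) < s generalizing s t
  · exact this hst.symm ht hs ((Fin.val_ne_of_ne hst).lt_of_le' (not_lt.mp h))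
  · have : ((t : ℕ) + 1) * (d - revealedLength S d) ≤ s * (d - revealedLength S d) :=
      Nat.mul_le_mul_right _ h
    omega

lemma card_hidden {m : ℕ} (s : Fin S) : #(hidden S (S * m) s) = m := by
  have hm : S * m - revealedLength S (S * m) = m := by
    rw [revealedLength, Nat.sub_sub_self (Nat.div_le_self _ _), Nat.mul_div_cancel_left m s.pos]
  have hs : ((s : ℕ) + 1) * m ≤ S * m := Nat.mul_le_mul_right m s.isLt
  have hmap : (hidden S (S * m) s).map Fin.valEmbedding =
      Finset.Ico ((s : ℕ) * m) (((s : ℕ) + 1) * m) := by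
    ext i
    simp only [hidden, hm, Finset.mem_map, Finset.mem_filter_univ, Finset.mem_Ico,
      Fin.valEmbedding_apply]
    exact ⟨fun ⟨_, hj, hji⟩ => hji ▸ hj, fun hi => ⟨⟨i, hi.2.trans_le hs⟩, hi, rfl⟩⟩
  rw [← Finset.card_map Fin.valEmbedding, hmap, Nat.card_Ico, ← Nat.sub_mul,
    Nat.add_sub_cancel_left, one_mul]

lemma one_sub_errorProb_le (hd : 0 < d) {s t : Fin S} (hst : t ≠ s) (A : Attack S d T s t)
    {w : ℝ} (hw : w ∈ Set.Icc 0 1) (hT : T * log d ≤ #(hidden S d s) * rate w) :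
    1 - errorProb A ≤ ((#((hidden S d t)ᶜ \ hidden S d s) + #(hidden S d s) * w) ^ 2 +
      2 * #(hidden S d s) * log (#(hidden S d s) + 1)) / (d * #(hidden S d t)ᶜ) := by
  have hsub : hidden S d s ⊆ (hidden S d t)ᶜ :=
    Finset.subset_compl_iff_disjoint_right.mpr (disjoint_hidden hst)
  have hcard : log (Fintype.card (Fin T → Fin d)) ≤ #(hidden S d s) * rate w := by
    simpa using hT
  simp only [one_sub_errorProb hd, probOne_eq hd, div_eq_inv_mul, outcomeMean_const_mul]
  gcongr
  exact outcomeMean_sq_agreement_le_of_subset (norm_copies hd) hcard hw hsub completion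

end Protocol

section Parameters

lemma h_mul_log_two (p : ℝ) : h p * log 2 = binEntropy p := by
  have hlog2 : log 2 ≠ 0 := (log_pos one_lt_two).ne'
  rw [h, binEntropy, logb, logb, one_div, one_div]
  field_simp

lemma mem_image_h {y : ℝ} (hy : y ∈ Set.Icc 0 1) : y ∈ h '' Set.Icc 0 (1 / 2) := by
  have hlog2 : log 2 ≠ 0 := (log_pos one_lt_two).ne'
  have h_eq : h = fun p => binEntropy p / log 2 := by
    funext p
    rw [← h_mul_log_two, mul_div_cancel_right₀ _ hlog2]
  have hcont : Continuous h := by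
    rw [h_eq]
    fun_prop
  refine intermediate_value_Icc (by norm_num) hcont.continuousOn ?_
  simpa only [h_eq, binEntropy_zero, zero_div, one_div, binEntropy_two_inv, div_self hlog2] using hy

lemma hInv_mem_Icc {y : ℝ} (hy : y ∈ Set.Icc 0 1) : hInv y ∈ Set.Icc 0 (1 / 2) :=
  Function.invFunOn_mem (mem_image_h hy)

lemma h_hInv {y : ℝ} (hy : y ∈ Set.Icc 0 1) : h (hInv y) = y :=
  Function.invFunOn_eq (mem_image_h hy)

lemma one_sub_two_mul_hInv_mem_Icc {y : ℝ} (hy : y ∈ Set.Icc 0 1) :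
    1 - 2 * hInv y ∈ Set.Icc 0 1 := by
  obtain ⟨hnonneg, hle⟩ := hInv_mem_Icc hy
  constructor <;> linarith

lemma rate_one_sub_two_mul_hInv {y : ℝ} (hy : y ∈ Set.Icc 0 1) :
    rate (1 - 2 * hInv y) = (1 - y) * log 2 := by
  rw [rate, show (1 - (1 - 2 * hInv y)) / 2 = hInv y by ring, ← h_mul_log_two, h_hInv hy]
  ring

variable {S m T : ℕ}

lemma one_sub_phi_div_alpha_mem_Icc (hS : 0 < S) (hm : 0 < m) (hφ : phi (S * m) T ≤ alpha S) :
    1 - phi (S * m) T / alpha S ∈ Set.Icc 0 1 := by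
  have hα : 0 < alpha S := by
    rw [alpha]
    positivity
  have hlogb : 0 ≤ logb 2 ((S * m : ℕ) : ℝ) :=
    logb_nonneg one_lt_two (by exact_mod_cast Nat.mul_pos hS hm)
  have hφ0 : 0 ≤ phi (S * m) T := by
    rw [phi]
    positivity
  exact ⟨sub_nonneg.mpr ((div_le_one hα).mpr hφ), sub_le_self 1 (by positivity)⟩

lemma mul_log_eq_mul_rate (hS : 0 < S) (hm : 0 < m) (hφ : phi (S * m) T ≤ alpha S) :
    T * log ((S * m : ℕ) : ℝ) =
      m * rate (1 - 2 * hInv (1 - phi (S * m) T / alpha S)) := by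
  have hlog2 : log 2 ≠ 0 := (log_pos one_lt_two).ne'
  rw [rate_one_sub_two_mul_hInv (one_sub_phi_div_alpha_mem_Icc hS hm hφ), sub_sub_cancel, phi,
    alpha, logb]
  push_cast
  field_simp

lemma cast_revealedLength (hS : 0 < S) : (revealedLength S (S * m) : ℝ) = S * m - m := by
  rw [revealedLength, Nat.mul_div_cancel_left m hS, Nat.cast_sub (Nat.le_mul_of_pos_left m hS),
    Nat.cast_mul]

lemma p1_eq (hS : 2 ≤ S) (hm : 0 < m) :
    p1 S (S * m) T =
      ((S * m - m - m + m * (1 - 2 * hInv (1 - phi (S * m) T / alpha S))) ^ 2 +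
        √(8 / 3) * √m * (S * m - m)) / (S * m * (S * m - m)) := by
  have hS' : (0 : ℝ) < S - 1 := by
    rw [sub_pos]
    exact_mod_cast hS
  have hα : 1 - alpha S = (S - 1) / S := by
    rw [alpha]
    field_simp
  have hαα : alpha S / (1 - alpha S) = 1 / (S - 1) := by
    rw [hα, alpha]
    field_simp
  rw [p1, hαα, hα, cast_revealedLength (by lia), Nat.cast_mul, sub_sub_cancel,
    show (S * m - m : ℝ) = (S - 1) * m by ring]
  field_simp
  ring

lemma cast_card_compl_hidden (t : Fin S) : (#(hidden S (S * m) t)ᶜ : ℝ) = S * m - m := by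
  rw [Finset.card_compl, Fintype.card_fin, card_hidden,
    Nat.cast_sub (Nat.le_mul_of_pos_left m t.pos), Nat.cast_mul]

lemma cast_card_compl_hidden_sdiff_hidden {s t : Fin S} (hst : t ≠ s) :
    (#((hidden S (S * m) t)ᶜ \ hidden S (S * m) s) : ℝ) = S * m - m - m := by
  rw [Finset.cast_card_sdiff (Finset.subset_compl_iff_disjoint_right.mpr (disjoint_hidden hst)),
    cast_card_compl_hidden, card_hidden]

end Parameters

end QSig

end

theorem proposition1 (S d T : ℕ) (hd : 0 < d) (hSd : S ∣ d)
    (hφ : QSig.phi d T ≤ QSig.alpha S) (s t : Fin S) (hst : t ≠ s)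
    (A : QSig.Attack S d T s t) :
    1 - QSig.errorProb A ≤ QSig.p1 S d T := by
  obtain ⟨m, rfl⟩ := hSd
  have hm : 0 < m := Nat.pos_of_mul_pos_left hd
  have hS : 2 ≤ S := by
    have := Fin.val_ne_of_ne hst
    lia
  have hml : (m : ℝ) ≤ S * m - m := by
    have hS' : (2 : ℝ) ≤ S := by exact_mod_cast hS
    nlinarith
  have hl : (0 : ℝ) ≤ S * m - m := m.cast_nonneg.trans hml
  have hbound := QSig.one_sub_errorProb_le hd hst A
    (QSig.one_sub_two_mul_hInv_mem_Icc (QSig.one_sub_phi_div_alpha_mem_Icc s.pos hm hφ))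
    (by rw [QSig.card_hidden, QSig.mul_log_eq_mul_rate s.pos hm hφ])
  rw [QSig.card_hidden, QSig.cast_card_compl_hidden, QSig.cast_card_compl_hidden_sdiff_hidden hst,
    Nat.cast_mul] at hbound
  rw [QSig.p1_eq hS hm]
  refine hbound.trans ?_
  gcongr (_ + ?_) / _
  exact QSig.two_mul_mul_log_succ_le hml
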